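/- Weighted search on $m$ rays. An instance $I$ consists of a goal $W\ge 0$ and, for every ray $i\in\{0,\dots,m-1\}$ of a star with origin $O$, a target of weight $w_i\ge 0$ at distance $d_i\in[1,\infty]$ from $O$, where $d_i=\infty$ means that ray $i$ holds no target. Let $T_I$ be the set of rays with $d_i<\infty$; it is assumed that $\sum_{i\in T_I}w_i\ge W$. For $S\subseteq T_I$ let $d_S=2\sum_{i\in S}d_i-\max_{i\in S}d_i$ (and $d_\emptyset=0$). Call $S\subseteq T_I$ feasible if $\sum_{i\in S}w_i\ge W$, let $\mathrm{opt}(I)$ be the minimum of $d_S$ over the feasible $S$, and let $s_I$ be the largest $|S|$ over the feasible $S$ with $d_S=\mathrm{opt}(I)$. Let $\phi(x)=1+2(1+x)(1+1/x)^x$ for $x>0$, and set $\phi(0)=3+2e$. Define $$\xi(I)=\min_{S\ \text{feasible}}\ \phi(m-|S|)\cdot\frac{d_S}{\mathrm{opt}(I)},$$ where, if $\mathrm{opt}(I)=0$ (which happens only for $W=0$), the quotient is read as $0$. The strategy AdSch searches without knowledge of the instance, as follows. Start with $f=1$, $r=0$, $D=1$ and the rays labelled $0,\dots,m-1$. Repeatedly,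 starting from $O$, explore the ray labelled $r$ up to distance $D\cdot b_{m,f}$ or until a target is found, where $b_{m,f}=1+\frac1{m-f}$ for $f<m$ and $b_{m,m}=\infty$ (the last remaining ray is searched without a bound), and return to $O$. If no target was found, replace $r$ by $r+1 \bmod (m-f+1)$ and $D$ by $D\cdot b_{m,f}$. If a target was found, increase $f$ by $1$, remove the ray, relabel the remaining rays in order by $0,\dots,m-f$, and replace $r$ by $r \bmod (m-f+1)$. The search stops at the first moment at which the targets found have total weight at least $W$, and its cost $c(\mathrm{AdSch},I)$ is the total distance traversed until that moment. Theorem. For every instance $I$, AdSch reaches its goal and $$c(\mathrm{AdSch},I)\le \xi(I)\cdot \mathrm{opt}(I).$$ Moreover $\xi(I)\le\phi(m-s_I)$, so this refines the bound $c(\mathrm{AdSch},I)\le\phi(m-s_I)\cdot\mathrm{opt}(I)$. -/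

import Mathlib

open scoped ENNReal
open Finset

noncomputable section

namespace WeightedSearch

/-- An instance of weighted search on a star with `m` rays.  Ray `i` carries a target of weight
`weight i` at distance `dist i` from the origin; `dist i = ⊤` means that no target is hidden on
ray `i` (and then `weight i` plays no role).  The goal is to collect total weight at least `W`,
and the targets that are present suffice for this. -/
structure Instance (m : ℕ) where
  W : ℝ
  dist : Fin m → ℝ≥0∞
  weight : Fin m → ℝ
  W_nonneg : 0 ≤ W
  one_le_dist : ∀ i, 1 ≤ dist i
  weight_nonneg : ∀ i, 0 ≤ weight i
  W_le_sum : W ≤ ∑ i with dist i ≠ ⊤, weight i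

namespace Instance

variable {m : ℕ} (I : Instance m)

/-- The set of targets, as a set of rays. -/
def targets : Finset (Fin m) := {i | I.dist i ≠ ⊤}

/-- The total weight of a set of targets. -/
def totalWeight (S : Finset (Fin m)) : ℝ := ∑ i ∈ S, I.weight i

/-- The optimal cost `d_S` of visiting all targets of `S` from the origin with full information
(the most distant target comes last, without return).  For `S = ∅` it is `0`. -/
def setCost (S : Finset (Fin m)) : ℝ :=
  2 * ∑ i ∈ S, (I.dist i).toReal - (S.sup I.dist).toReal

open Classical in
/-- The sets of targets of total weight at least `W`. -/
def feasible : Finset (Finset (Fin m)) := {S ∈ I.targets.powerset | I.W ≤ I.totalWeight S}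

theorem feasible_nonempty : I.feasible.Nonempty :=
  ⟨I.targets, by
    simp only [feasible, mem_filter, mem_powerset, Subset.refl, true_and]
    exact I.W_le_sum⟩

/-- The optimal full-information cost of the instance. -/
def opt : ℝ := I.feasible.inf' I.feasible_nonempty I.setCost

open Classical in
/-- The largest number of targets in a feasible set of optimal cost. -/
def maxOptCard : ℕ := ({S ∈ I.feasible | I.setCost S = I.opt} : Finset (Finset (Fin m))).sup card

end Instance

/-- The function `φ(x) = 1 + 2 (1 + x) (1 + 1 / x) ^ x`, meant for `x > 0`. -/
def phi (x : ℝ) : ℝ := 1 + 2 * (1 + x) * (1 + 1 / x) ^ x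

/-- The competitive factor for searching a prescribed set of targets that leaves out `q` of the
rays: `φ(q)` for `q > 0`, and `3 + 2e` in the extreme case `q = 0`, in which all rays
must be searched. -/
def factor (q : ℕ) : ℝ := if q = 0 then 3 + 2 * Real.exp 1 else phi q

/-- The parameter `ξ(I)`: the minimum over the feasible `S` of `φ(m - |S|) * d_S / opt`. -/
def Instance.xi {m : ℕ} (I : Instance m) : ℝ :=
  I.feasible.inf' I.feasible_nonempty fun S => factor (m - S.card) * (I.setCost S / I.opt)

/-! ### The adaptive strategy -/

/-- A configuration of the adaptive strategy, at the far end of the last exploration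
(initially: at the origin). -/
structure State (m : ℕ) where
  /-- the rays that are left; position in the list is the current label -/
  rays : List (Fin m)
  /-- one plus the number of targets found -/
  f : ℕ
  /-- the label of the ray to explore next -/
  r : ℕ
  /-- the length of the last exploration that found no target (initially `1`) -/
  D : ℝ
  /-- the targets found -/
  found : Finset (Fin m)
  /-- the total distance traversed up to this moment -/
  travelled : ℝ≥0∞
  /-- the distance of the searcher from the origin -/
  away : ℝ≥0∞

/-- The base `b_{m,f} = 1 + 1 / (m - f)`, meant for `f < m`. -/
def base (m f : ℕ) : ℝ := 1 + 1 / ((m : ℝ) - f)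

/-- The depth `D * b_{m,f}` of the next exploration; the last ray (`f = m`, where
`b_{m,f}` is infinite) is explored without a bound. -/
def depth (m f : ℕ) (D : ℝ) : ℝ≥0∞ := if f < m then ENNReal.ofReal (D * base m f) else ⊤

/-- The initial configuration. -/
def State.init (m : ℕ) : State m where
  rays := List.finRange m
  f := 1
  r := 0
  D := 1
  found := ∅
  travelled := 0
  away := 0

open Classical in
/-- Return to the origin and explore the ray labelled `r` up to the current depth or until its
target is found.  If no target is found, go on to the cyclically next ray and record the length.
If a target is found, remove the ray and relabel the others in order. -/
def step {m : ℕ} (I : Instance m) (s : State m) : State m :=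
  match s.rays[s.r]? with
  | none => s
  | some i =>
    if I.dist i ≠ ⊤ ∧ I.dist i ≤ depth m s.f s.D then
      { rays := s.rays.eraseIdx s.r
        f := s.f + 1
        r := s.r % (m - s.f)
        D := s.D
        found := insert i s.found
        travelled := s.travelled + s.away + I.dist i
        away := I.dist i }
    else
      { rays := s.rays
        f := s.f
        r := (s.r + 1) % (m - s.f + 1)
        D := s.D * base m s.f
        found := s.found
        travelled := s.travelled + s.away + depth m s.f s.D
        away := depth m s.f s.D }

/-- The configuration after `k` explorations. -/
def run {m : ℕ} (I : Instance m) (k : ℕ) : State m := (step I)^[k] (State.init m)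

open Classical in
/-- The cost of the adaptive strategy: the total distance traversed until the first moment at which
the targets found have total weight at least `W` (`⊤` if this never happens). -/
def adSchCost {m : ℕ} (I : Instance m) : ℝ≥0∞ :=
  if h : ∃ k, I.W ≤ I.totalWeight (run I k).found then (run I (Nat.find h)).travelled else ⊤

end WeightedSearch

end

noncomputable section

namespace WeightedSearch

/-! ### Powers of `1 + 1 / n` -/

theorem one_add_inv_pow_le_succ {j n : ℕ} (h : j ≤ n) :
    (1 + 1 / (n : ℝ)) ^ j ≤ (1 + 1 / ((n : ℝ) + 1)) ^ (j + 1) := by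
  rcases Nat.eq_zero_or_pos j with rfl | hj
  · have : (0 : ℝ) ≤ 1 / ((n : ℝ) + 1) := by positivity
    simpa using this
  have hj' : (0 : ℝ) < j := by exact_mod_cast hj
  have hn' : (0 : ℝ) < n := lt_of_lt_of_le hj' (by exact_mod_cast h)
  have hjn : (j : ℝ) ≤ n := by exact_mod_cast h
  have hp : (1 : ℝ) ≤ ((j : ℝ) + 1) / j := by
    rw [le_div_iff₀ hj']; linarith
  have hs : (-1 : ℝ) ≤ 1 / ((n : ℝ) + 1) := le_trans (by norm_num : (-1 : ℝ) ≤ 0) (by positivity)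
  have hB := one_add_mul_self_le_rpow_one_add hs hp
  have h1 : 1 + 1 / (n : ℝ) ≤ (1 + 1 / ((n : ℝ) + 1)) ^ (((j : ℝ) + 1) / j) := by
    refine le_trans ?_ hB
    rw [div_mul_div_comm, add_le_add_iff_left, div_le_div_iff₀ hn' (by positivity)]
    nlinarith
  calc (1 + 1 / (n : ℝ)) ^ j ≤ ((1 + 1 / ((n : ℝ) + 1)) ^ (((j : ℝ) + 1) / j)) ^ j := by
        gcongr
    _ = (1 + 1 / ((n : ℝ) + 1)) ^ (j + 1) := by
        rw [← Real.rpow_mul_natCast (by positivity), div_mul_cancel₀ _ hj'.ne']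
        exact_mod_cast Real.rpow_natCast (1 + 1 / ((n : ℝ) + 1)) (j + 1)

/-- The quantity `(1 + 1 / n) ^ n`, which is `1` for `n = 0`. -/
def growth (n : ℕ) : ℝ := (1 + 1 / (n : ℝ)) ^ n

theorem growth_mono : Monotone growth :=
  monotone_nat_of_le_succ fun n => by
    simpa [growth] using one_add_inv_pow_le_succ (le_refl n)

theorem growth_zero : growth 0 = 1 := by simp [growth]

theorem two_le_growth {n : ℕ} (h : 1 ≤ n) : 2 ≤ growth n := by
  have := growth_mono h
  norm_num [growth] at this ⊢
  exact this

theorem one_le_growth (n : ℕ) : 1 ≤ growth n := growth_zero ▸ growth_mono (Nat.zero_le n)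

theorem one_add_inv_pow_le_exp {j n : ℕ} (h : j ≤ n) :
    (1 + 1 / (n : ℝ)) ^ j ≤ Real.exp 1 := by
  rcases Nat.eq_zero_or_pos n with rfl | hn
  · obtain rfl : j = 0 := by omega
    simp
  have hn' : (0 : ℝ) < n := by exact_mod_cast hn
  calc (1 + 1 / (n : ℝ)) ^ j ≤ (1 + 1 / (n : ℝ)) ^ n :=
        pow_le_pow_right₀ (by have : (0:ℝ) ≤ 1 / (n:ℝ) := by positivity
                              linarith) h
    _ ≤ (Real.exp (1 / n)) ^ n := by
        gcongr
        linarith [Real.add_one_le_exp (1 / (n : ℝ))]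
    _ = Real.exp 1 := by
        rw [← Real.exp_nat_mul, mul_one_div_cancel hn'.ne']

theorem one_add_inv_pow_le_growth {j n : ℕ} (h : j ≤ n) :
    (1 + 1 / (n : ℝ)) ^ j ≤ growth n :=
  pow_le_pow_right₀ (by have : (0:ℝ) ≤ 1 / (n:ℝ) := by positivity
                        linarith) h

/-- Finding a foreign target during the last round is not worse for the searcher than exploring the
same ray in vain. -/
theorem round_cost_le {j n : ℕ} (h : j ≤ n) :
    (1 + 1 / ((n : ℝ) + 1)) + ((n : ℝ) + 1) * ((1 + 1 / (n : ℝ)) ^ j - 1) ≤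
      ((n : ℝ) + 2) * ((1 + 1 / ((n : ℝ) + 1)) ^ (j + 1) - 1) := by
  induction j with
  | zero =>
    have : ((n : ℝ) + 1) * (1 / ((n : ℝ) + 1)) = 1 := mul_one_div_cancel (by positivity)
    simp only [pow_zero, zero_add, pow_one]
    linarith
  | succ j ih =>
    have ih := ih (by omega)
    have hA := one_add_inv_pow_le_succ h
    have hn : (n : ℝ) ≠ 0 := by
      have : n ≠ 0 := by omega
      exact_mod_cast this
    have hn1 : (n : ℝ) + 1 ≠ 0 := by positivity
    have e1 : ((n : ℝ) + 1) * (1 + 1 / (n : ℝ)) ^ (j + 1) =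
        ((n : ℝ) + 1) * (1 + 1 / (n : ℝ)) ^ j + (1 + 1 / (n : ℝ)) ^ (j + 1) := by
      rw [pow_succ]; field_simp
    have e2 : ((n : ℝ) + 2) * (1 + 1 / ((n : ℝ) + 1)) ^ (j + 1 + 1) =
        ((n : ℝ) + 2) * (1 + 1 / ((n : ℝ) + 1)) ^ (j + 1) +
          (1 + 1 / ((n : ℝ) + 1)) ^ (j + 1 + 1) := by
      rw [pow_succ (1 + 1 / ((n : ℝ) + 1)) (j + 1)]; field_simp; ring
    rw [mul_sub, mul_sub] at ih ⊢
    linarith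

/-! ### The amortised analysis of the queue of rays -/

variable {α : Type*} [DecidableEq α]

/-- The number of rays in the list `Q` that lie outside of `S`. -/
def others (S : Finset α) (Q : List α) : ℕ := Q.countP (· ∉ S)

theorem others_cons_of_mem {S : Finset α} {a : α} (h : a ∈ S) (Q : List α) :
    others S (a :: Q) = others S Q := by simp [others, h]

theorem others_cons_of_notMem {S : Finset α} {a : α} (h : a ∉ S) (Q : List α) :
    others S (a :: Q) = others S Q + 1 := by simp [others, h]

theorem others_append (S : Finset α) (P Q : List α) :
    others S (P ++ Q) = others S P + others S Q := by simp [others]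

theorem others_le_length (S : Finset α) (Q : List α) : others S Q ≤ Q.length :=
  List.countP_le_length

theorem others_lt_length {S : Finset α} {Q : List α} {i : α} (hi : i ∈ Q) (hS : i ∈ S) :
    others S Q < Q.length := by
  obtain ⟨A, B, rfl⟩ := List.append_of_mem hi
  have h1 := others_le_length S A
  have h2 := others_le_length S B
  simp only [others_append, others_cons_of_mem hS, List.length_append, List.length_cons]
  omega

/-- The invariant of the search for the targets `S`, located at distances `d`.  The rays left are
listed in `Q` in the order in which they will be explored, and `q` rays lie outside of `S`.  `D` is
the length of the last vain exploration, `T` the total length of all explorations, `F` the total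
distance of the members of `S` found so far, and `C` is the part of `T` which is charged to the
last target of `S`. -/
structure Invariant (S : Finset α) (d : α → ℝ) (q : ℕ) (Q : List α) (D C T F : ℝ) : Prop where
  one_le : 1 ≤ D
  others_le : others S Q ≤ q
  charge_le : 2 ≤ Q.length →
    C ≤ (q + 1) * D + (q - others S Q) * (D * (1 + 1 / ((Q.length : ℝ) - 1)))
  depth_le : ∀ A i B, Q = A ++ i :: B → i ∈ S →
    D * (1 + 1 / ((Q.length : ℝ) - 1)) ^ A.length ≤ Real.exp 1 * d i
  potential_le : ∀ A i B, Q = A ++ i :: B → i ∈ S → (∀ j ∈ B, j ∉ S) →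
    C + (others S Q + 1) * (D * ((1 + 1 / (others S Q : ℝ)) ^ others S A - 1)) ≤
      (q + 1) * growth q * d i
  total_le : T ≤ C + (1 + Real.exp 1) * F + ((Q.length : ℝ) - others S Q - 1) * D

namespace Invariant

variable {S : Finset α} {d : α → ℝ} {q : ℕ} {a : α} {R : List α} {D C T F : ℝ}

theorem initial {Q : List α} (hq : others S Q = q) (hd : ∀ i ∈ S, 1 ≤ d i)
    (hS : ∃ i ∈ Q, i ∈ S) : Invariant S d q Q 1 0 0 0 where
  one_le := le_rfl
  others_le := hq.le
  charge_le _ := by simp only [hq]; nlinarith [(Nat.cast_nonneg q : (0:ℝ) ≤ q)]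
  depth_le A i B h hi := by
    have hl : ((Q.length : ℝ) - 1) = ((A.length + B.length : ℕ) : ℝ) := by
      rw [h]; push_cast [List.length_append, List.length_cons]; ring
    rw [hl, one_mul]
    have := one_add_inv_pow_le_exp (Nat.le_add_right A.length B.length)
    nlinarith [hd i hi, Real.exp_pos 1]
  potential_le A i B h hi _ := by
    have hle : others S A ≤ q := by rw [← hq, h, others_append]; omega
    have h1 := one_add_inv_pow_le_growth hle
    have h2 := hd i hi
    have h3 := one_le_growth q
    rw [hq, zero_add, one_mul, mul_assoc]
    apply mul_le_mul_of_nonneg_left _ (by positivity)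
    nlinarith
  total_le := by
    obtain ⟨i, hi, hiS⟩ := hS
    have : ((others S Q + 1 : ℕ) : ℝ) ≤ Q.length := by exact_mod_cast others_lt_length hi hiS
    push_cast at this
    linarith

theorem found_mem (h : Invariant S d q (a :: R) D C T F) (ha : a ∈ S) (hR : R ≠ []) :
    Invariant S d q R D C (T + d a) (F + d a) := by
  have hD := h.one_le
  have hq : (others S R : ℝ) ≤ q := by
    have := h.others_le
    rw [others_cons_of_mem ha] at this
    exact_mod_cast this
  have hpos : 0 < R.length := List.length_pos_iff.2 hR
  have hlen : (((a :: R).length : ℝ) - 1) = R.length := by simp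
  constructor
  · exact hD
  · exact_mod_cast hq
  · intro h2
    have h3 := h.charge_le (by simp only [List.length_cons]; omega)
    rw [hlen, others_cons_of_mem ha] at h3
    have h4 : (1:ℝ) / R.length ≤ 1 / ((R.length : ℝ) - 1) := by
      have : (2:ℝ) ≤ R.length := by exact_mod_cast h2
      exact one_div_le_one_div_of_le (by linarith) (by linarith)
    have h5 : (0:ℝ) ≤ q - others S R := by linarith
    refine h3.trans ?_
    gcongr
  · intro A i B hi hiS
    have h3 := h.depth_le (a :: A) i B (by rw [hi]; rfl) hiS
    rw [hlen] at h3
    refine le_trans ?_ h3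
    obtain ⟨n, hn⟩ : ∃ n, R.length = n + 1 := ⟨R.length - 1, by omega⟩
    have hAn : A.length ≤ n := by
      rw [hi, List.length_append, List.length_cons] at hn; omega
    have := one_add_inv_pow_le_succ hAn
    rw [hn, List.length_cons]
    push_cast
    rw [add_sub_cancel_right]
    gcongr
  · intro A i B hi hiS hB
    have h3 := h.potential_le (a :: A) i B (by rw [hi]; rfl) hiS hB
    rwa [others_cons_of_mem ha, others_cons_of_mem ha] at h3
  · have h3 := h.total_le
    have h4 := h.depth_le [] a R rfl ha
    rw [others_cons_of_mem ha, List.length_cons] at h3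
    push_cast at h3
    simp only [List.length_nil, pow_zero, mul_one] at h4
    nlinarith

theorem found_notMem (h : Invariant S d q (a :: R) D C T F) (ha : a ∉ S)
    (hS : ∃ i ∈ R, i ∈ S) (hd : d a ≤ D * (1 + 1 / (R.length : ℝ))) :
    Invariant S d q R D (C + d a) (T + d a) F := by
  have hD := h.one_le
  have hq : ((others S R : ℝ) + 1) ≤ q := by
    have := h.others_le
    rw [others_cons_of_notMem ha] at this
    exact_mod_cast this
  obtain ⟨i₀, hi₀, hi₀S⟩ := hS
  have hlt := others_lt_length hi₀ hi₀S
  have hpos : 0 < R.length := by omega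
  have hlen : (((a :: R).length : ℝ) - 1) = R.length := by simp
  constructor
  · exact hD
  · have : (others S R : ℝ) ≤ q := by linarith
    exact_mod_cast this
  · intro h2
    have h3 := h.charge_le (by simp only [List.length_cons]; omega)
    rw [hlen, others_cons_of_notMem ha] at h3
    push_cast at h3
    have h4 : (1:ℝ) / R.length ≤ 1 / ((R.length : ℝ) - 1) := by
      have : (2:ℝ) ≤ R.length := by exact_mod_cast h2
      exact one_div_le_one_div_of_le (by linarith) (by linarith)
    have h5 : (0:ℝ) ≤ q - others S R := by linarith
    calc C + d a ≤ (q + 1) * D + (q - others S R) * (D * (1 + 1 / (R.length : ℝ))) := by linarith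
      _ ≤ _ := by gcongr
  · intro A i B hi hiS
    have h3 := h.depth_le (a :: A) i B (by rw [hi]; rfl) hiS
    rw [hlen] at h3
    refine le_trans ?_ h3
    obtain ⟨n, hn⟩ : ∃ n, R.length = n + 1 := ⟨R.length - 1, by omega⟩
    have hAn : A.length ≤ n := by
      rw [hi, List.length_append, List.length_cons] at hn; omega
    have := one_add_inv_pow_le_succ hAn
    rw [hn, List.length_cons]
    push_cast
    rw [add_sub_cancel_right]
    gcongr
  · intro A i B hi hiS hB
    have h3 := h.potential_le (a :: A) i B (by rw [hi]; rfl) hiS hB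
    rw [others_cons_of_notMem ha, others_cons_of_notMem ha] at h3
    push_cast at h3
    have hA : others S A ≤ others S R := by rw [hi, others_append]; omega
    have h4 := round_cost_le hA
    have h5 : (1:ℝ) / R.length ≤ 1 / ((others S R : ℝ) + 1) :=
      one_div_le_one_div_of_le (by positivity) (by exact_mod_cast hlt)
    have h6 : D * (1 + 1 / (R.length : ℝ)) ≤ D * (1 + 1 / ((others S R : ℝ) + 1)) := by gcongr
    have h7 := mul_le_mul_of_nonneg_left h4 (by linarith : 0 ≤ D)
    linarith
  · have h3 := h.total_le
    rw [others_cons_of_notMem ha, List.length_cons] at h3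
    push_cast at h3
    linarith

theorem vain (h : Invariant S d q (a :: R) D C T F) (hR : R ≠ [])
    (hd : a ∈ S → D * (1 + 1 / (R.length : ℝ)) ≤ d a) :
    Invariant S d q (R ++ [a]) (D * (1 + 1 / (R.length : ℝ)))
      (C + (others S (a :: R) + 1) * (D / R.length)) (T + D * (1 + 1 / (R.length : ℝ))) F := by
  have hD := h.one_le
  have hpos : 0 < R.length := List.length_pos_iff.2 hR
  have hpos' : (0:ℝ) < R.length := by exact_mod_cast hpos
  have hq : (others S (a :: R) : ℝ) ≤ q := by exact_mod_cast h.others_le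
  have hlen : (((a :: R).length : ℝ) - 1) = R.length := by simp
  have hlen' : (((R ++ [a]).length : ℝ) - 1) = R.length := by simp
  have hoth : others S (R ++ [a]) = others S (a :: R) := by
    rw [others_append]; by_cases ha : a ∈ S <;> simp [others, ha]
  have hDD : D ≤ D * (1 + 1 / (R.length : ℝ)) := by
    have : 0 ≤ D * (1 / (R.length : ℝ)) := by positivity
    linarith
  have hdiv : D / R.length = D * (1 + 1 / (R.length : ℝ)) - D := by ring
  have hcharge : C + (others S (a :: R) + 1) * (D / R.length) ≤
      (q + 1) * (D * (1 + 1 / (R.length : ℝ))) +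
        (q - others S (a :: R)) * (D * (1 + 1 / (R.length : ℝ))) := by
    have h3 := h.charge_le (by simp only [List.length_cons]; omega)
    rw [hlen] at h3
    have h4 : ((others S (a :: R) : ℝ) + 1) * (D / R.length) ≤ (q + 1) * (D / R.length) := by
      gcongr
    have h5 : (q + 1) * (D / R.length) =
      (q + 1) * (D * (1 + 1 / (R.length : ℝ))) - (q + 1) * D := by rw [hdiv]; ring
    linarith
  constructor
  · linarith
  · rw [hoth]; exact h.others_le
  · intro _
    rw [hoth, hlen']
    refine hcharge.trans ?_
    have h5 : (0:ℝ) ≤ q - others S (a :: R) := by linarith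
    gcongr
  · intro A i B hi hiS
    rw [hlen']
    rcases List.eq_nil_or_concat B with rfl | ⟨B', b, rfl⟩
    · obtain ⟨rfl, hia⟩ := List.append_inj' hi rfl
      obtain rfl : a = i := by simpa using hia
      have := one_add_inv_pow_le_exp (le_refl R.length)
      have h6 := hd hiS
      calc D * (1 + 1 / (R.length : ℝ)) * (1 + 1 / (R.length : ℝ)) ^ R.length
          ≤ d a * Real.exp 1 := by gcongr; linarith
        _ = _ := mul_comm _ _
    · have hi' : R ++ [a] = (A ++ i :: B') ++ [b] := by simpa using hi
      obtain ⟨hRR, hab⟩ := List.append_inj' hi' rfl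
      have h3 := h.depth_le (a :: A) i B' (by rw [hRR]; rfl) hiS
      rw [hlen, List.length_cons, pow_succ] at h3
      linarith
  · intro A i B hi hiS hB
    rw [hoth]
    rcases List.eq_nil_or_concat B with rfl | ⟨B', b, rfl⟩
    · obtain ⟨rfl, hia⟩ := List.append_inj' hi rfl
      obtain rfl : a = i := by simpa using hia
      have h6 := hd hiS
      rw [others_cons_of_mem hiS] at hq hcharge ⊢
      have hg : (1 + 1 / (others S R : ℝ)) ^ others S R = growth (others S R) := rfl
      rw [hg]
      set y := D * (1 + 1 / (R.length : ℝ)) with hy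
      have hgm : growth (others S R) ≤ growth q := growth_mono (by exact_mod_cast hq)
      have key : 2 * ((q : ℝ) - others S R) + (others S R + 1) * growth (others S R) ≤
          (q + 1) * growth q := by
        have h7 : 2 * ((q : ℝ) - others S R) ≤ growth q * (q - others S R) := by
          rcases Nat.eq_zero_or_pos q with rfl | hq0
          · have : (others S R : ℝ) = 0 :=
              le_antisymm (by simpa using hq) (Nat.cast_nonneg _)
            simp [this]
          · exact mul_le_mul_of_nonneg_right (two_le_growth hq0) (by linarith)
        have h8 : ((others S R : ℝ) + 1) * growth (others S R) ≤
          (others S R + 1) * growth q := by gcongr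
        linarith
      calc _ ≤ (q + 1) * y + (q - others S R) * y +
            (others S R + 1) * (y * (growth (others S R) - 1)) := by linarith
        _ = (2 * ((q : ℝ) - others S R) + (others S R + 1) * growth (others S R)) * y := by ring
        _ ≤ ((q + 1) * growth q) * y := mul_le_mul_of_nonneg_right key (by linarith)
        _ ≤ _ := mul_le_mul_of_nonneg_left h6
            (mul_nonneg (by positivity) (zero_le_one.trans (one_le_growth q)))
    · have hi' : R ++ [a] = (A ++ i :: B') ++ [b] := by simpa using hi
      obtain ⟨hRR, hab⟩ := List.append_inj' hi' rfl
      obtain rfl : a = b := by simpa using hab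
      have haS : a ∉ S := hB a (by simp)
      have h3 := h.potential_le (a :: A) i B' (by rw [hRR]; rfl) hiS
        (fun j hj => hB j (by simp [hj]))
      rw [others_cons_of_notMem haS A, pow_succ] at h3
      have hlt : others S (a :: R) ≤ R.length := by
        rw [others_cons_of_notMem haS]
        exact others_lt_length (i := i) (by rw [hRR]; simp) hiS
      have hx0 : 0 < others S (a :: R) := by rw [others_cons_of_notMem haS]; omega
      have h5 : (1:ℝ) / R.length ≤ 1 / (others S (a :: R) : ℝ) :=
        one_div_le_one_div_of_le (by exact_mod_cast hx0) (by exact_mod_cast hlt)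
      set x : ℝ := (others S (a :: R) : ℝ) with hx
      have hxp : 0 ≤ x := by positivity
      refine le_trans ?_ h3
      have h6 : D * (1 + 1 / (R.length : ℝ)) * (1 + 1 / x) ^ others S A ≤
          D * (1 + 1 / x) * (1 + 1 / x) ^ others S A := by gcongr
      have h7 := mul_le_mul_of_nonneg_left h6 (by positivity : 0 ≤ x + 1)
      rw [hdiv]
      linarith
  · have h3 := h.total_le
    rw [hoth]
    rw [List.length_cons] at h3
    simp only [List.length_append, List.length_cons, List.length_nil]
    push_cast at h3 ⊢
    have e : D * (1 + 1 / (R.length : ℝ)) = (R.length + 1) * (D / R.length) := by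
      field_simp
    rw [hdiv] at *
    nlinarith

theorem found_last (h : Invariant S d q (a :: R) D C T F) (ha : a ∈ S) (hR : ∀ j ∈ R, j ∉ S) :
    T ≤ (q + 1) * growth q * d a + (1 + Real.exp 1) * F := by
  have h1 := h.total_le
  have h2 := h.potential_le [] a R rfl ha hR
  have h3 : others S R = R.length := List.countP_eq_length.2 (by simpa using hR)
  rw [others_cons_of_mem ha, h3, List.length_cons] at h1
  push_cast at h1
  simp only [others, List.countP_nil, pow_zero, sub_self, mul_zero, add_zero] at h2
  linarith

end Invariant

/-! ### The adaptive strategy as a search through a queue -/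

variable {m : ℕ}

/-- The distance of the target on ray `i` as a real number. -/
def Instance.realDist (I : Instance m) (i : Fin m) : ℝ := (I.dist i).toReal

theorem Instance.ofReal_realDist (I : Instance m) {i : Fin m} (h : I.dist i ≠ ⊤) :
    ENNReal.ofReal (I.realDist i) = I.dist i := ENNReal.ofReal_toReal h

theorem Instance.one_le_realDist (I : Instance m) {i : Fin m} (h : I.dist i ≠ ⊤) :
    1 ≤ I.realDist i := by
  simpa [Instance.realDist] using (ENNReal.toReal_le_toReal ENNReal.one_ne_top h).2 (I.one_le_dist i)

theorem Instance.mem_targets (I : Instance m) {i : Fin m} : i ∈ I.targets ↔ I.dist i ≠ ⊤ := by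
  simp [Instance.targets]

/-- The state `s` of the adaptive strategy is consistent and satisfies the invariant of the search
for `S`. -/
structure Progress (I : Instance m) (S : Finset (Fin m)) (s : State m) : Prop where
  r_lt : s.r < s.rays.length
  length_add : s.rays.length + s.f = m + 1
  nodup : s.rays.Nodup
  mem_iff : ∀ i, i ∈ s.rays ↔ i ∉ s.found
  exists_invariant : ∃ C T : ℝ, 0 ≤ T ∧ s.travelled + s.away = ENNReal.ofReal (2 * T) ∧
    Invariant S I.realDist (m - S.card) (s.rays.rotate s.r) s.D C T
      (∑ i ∈ S ∩ s.found, I.realDist i)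

/-- A bound for the cost of the search for `S` if the ray `i` is the last one to be completed. -/
def lastBound (I : Instance m) (S : Finset (Fin m)) (i : Fin m) : ℝ :=
  2 * (((m - S.card : ℕ) + 1) * growth (m - S.card) * I.realDist i +
    (1 + Real.exp 1) * ∑ j ∈ S.erase i, I.realDist j) + I.realDist i

theorem others_finRange (S : Finset (Fin m)) : others S (List.finRange m) = m - S.card := by
  have h1 : others S (List.finRange m) = (Sᶜ).card := by
    rw [others, List.countP_eq_length_filter, ← List.toFinset_card_of_nodup
      ((List.nodup_finRange m).filter _)]
    congr 1
    ext i
    simp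
  rw [h1, card_compl, Fintype.card_fin]

theorem Progress.init (I : Instance m) {S : Finset (Fin m)} (hS : S ⊆ I.targets)
    (hne : S.Nonempty) : Progress I S (State.init m) where
  r_lt := by
    obtain ⟨i, -⟩ := hne
    simpa [State.init] using i.pos
  length_add := by simp [State.init]
  nodup := List.nodup_finRange m
  mem_iff i := by simp [State.init]
  exists_invariant := by
    refine ⟨0, 0, le_rfl, by simp [State.init], ?_⟩
    obtain ⟨i, hi⟩ := hne
    have := Invariant.initial (S := S) (d := I.realDist) (others_finRange S)
      (fun j hj => I.one_le_realDist (I.mem_targets.1 (hS hj))) ⟨i, List.mem_finRange i, hi⟩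
    simpa [State.init] using this

theorem rotate_eq_cons {α : Type*} {l : List α} {r : ℕ} (h : r < l.length) :
    l.rotate r = l[r] :: (l.drop (r + 1) ++ l.take r) := by
  rw [List.rotate_eq_drop_append_take h.le, List.drop_eq_getElem_cons h, List.cons_append]

theorem eraseIdx_rotate {α : Type*} {l : List α} {r : ℕ} (h : r < l.length) :
    (l.eraseIdx r).rotate r = l.drop (r + 1) ++ l.take r := by
  have hl : (l.take r).length = r := by simp [h.le]
  rw [List.eraseIdx_eq_take_drop_succ]
  conv_lhs => arg 2; rw [← hl]
  rw [List.rotate_append_length_eq]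

theorem depth_eq {n f : ℕ} (h : n + f = m) (hn : 0 < n) (D : ℝ) :
    depth m f D = ENNReal.ofReal (D * (1 + 1 / (n : ℝ))) ∧ base m f = 1 + 1 / (n : ℝ) := by
  have hb : base m f = 1 + 1 / (n : ℝ) := by
    rw [base, ← h]; push_cast; rw [add_sub_cancel_right]
  rw [depth, if_pos (by omega), hb]
  exact ⟨rfl, rfl⟩

theorem Progress.step {I : Instance m} {S : Finset (Fin m)} {s : State m} (h : Progress I S s)
    (hS : S ⊆ I.targets) (hne : ¬ S ⊆ s.found) :
    (S ⊆ (step I s).found ∧ ∃ i ∈ S,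
      (step I s).travelled ≤ ENNReal.ofReal (lastBound I S i)) ∨
    (Progress I S (step I s) ∧ ¬ S ⊆ (step I s).found ∧
      s.D * m + s.f + 1 ≤ (step I s).D * m + (step I s).f) := by
  obtain ⟨hr, hlen, hnd, hmem, C, T, hT, htr, hinv⟩ := h
  have hlookup : s.rays[s.r]? = some s.rays[s.r] := List.getElem?_eq_getElem hr
  have hQ := rotate_eq_cons hr
  have her := eraseIdx_rotate hr
  set a := s.rays[s.r] with ha
  set R := s.rays.drop (s.r + 1) ++ s.rays.take s.r with hR
  have hRl : R.length + 1 = s.rays.length := by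
    have := congrArg List.length hQ
    simpa using this.symm
  have hQmem : ∀ i, i ∈ a :: R ↔ i ∉ s.found := fun i => by
    rw [← hmem, ← hQ, List.mem_rotate]
  have hQnd : (a :: R).Nodup := by rw [← hQ]; exact List.nodup_rotate.2 hnd
  have haR : a ∉ R := (List.nodup_cons.1 hQnd).1
  have hafound : a ∉ s.found := (hQmem a).1 List.mem_cons_self
  rw [hQ] at hinv
  have hDone := hinv.one_le
  obtain ⟨i₀, hi₀S, hi₀⟩ : ∃ i ∈ S, i ∉ s.found := by
    simpa [Finset.subset_iff] using hne
  have hi₀Q : i₀ ∈ a :: R := (hQmem i₀).2 hi₀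
  have hone : R = [] → a ∈ S := by
    intro h0
    rw [h0, List.mem_singleton] at hi₀Q
    exact hi₀Q ▸ hi₀S
  have hRf : R.length + s.f = m := by omega
  by_cases hc : I.dist a ≠ ⊤ ∧ I.dist a ≤ depth m s.f s.D
  · have hstep : WeightedSearch.step I s =
      { rays := s.rays.eraseIdx s.r
        f := s.f + 1
        r := s.r % (m - s.f)
        D := s.D
        found := insert a s.found
        travelled := s.travelled + s.away + I.dist a
        away := I.dist a } := by
      simp only [WeightedSearch.step, hlookup]
      rw [if_pos hc]
    have hda := I.one_le_realDist hc.1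
    rw [hstep]
    by_cases hlast : ∃ i ∈ R, i ∈ S
    · right
      obtain ⟨j, hjR, hjS⟩ := hlast
      have hR0 : R ≠ [] := List.ne_nil_of_mem hjR
      have hRpos : 0 < R.length := List.length_pos_iff.2 hR0
      have hel : (s.rays.eraseIdx s.r).length = R.length := by
        rw [List.length_eraseIdx_of_lt hr]; omega
      have hmf : m - s.f = R.length := by omega
      have hmem' : ∀ i, i ∈ R ↔ i ∉ insert a s.found := by
        intro i
        rw [Finset.mem_insert, not_or, ← hQmem, List.mem_cons]
        constructor
        · intro hi
          exact ⟨fun h => haR (h ▸ hi), Or.inr hi⟩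
        · rintro ⟨h1, h2⟩
          exact h2.resolve_left h1
      have hrot : (s.rays.eraseIdx s.r).rotate (s.r % (m - s.f)) = R := by
        rw [hmf, ← hel, List.rotate_mod, her]
      have htr' : s.travelled + s.away + I.dist a + I.dist a =
          ENNReal.ofReal (2 * (T + I.realDist a)) := by
        rw [htr, ← I.ofReal_realDist hc.1, ← ENNReal.ofReal_add (by positivity) (by positivity),
          ← ENNReal.ofReal_add (by positivity) (by positivity)]
        congr 1; ring
      refine ⟨⟨?_, ?_, ?_, ?_, ?_⟩, ?_, ?_⟩
      · simp only [hel, hmf]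
        exact Nat.mod_lt _ hRpos
      · simp only [hel]; omega
      · exact hnd.eraseIdx _
      · intro i
        simp only
        rw [← hmem', ← hrot, List.mem_rotate]
      · simp only [hrot]
        by_cases haS : a ∈ S
        · refine ⟨C, T + I.realDist a, by positivity, htr', ?_⟩
          rw [Finset.inter_insert_of_mem haS, Finset.sum_insert (by simp [hafound]),
            add_comm (I.realDist a)]
          exact hinv.found_mem haS hR0
        · refine ⟨C + I.realDist a, T + I.realDist a, by positivity, htr', ?_⟩
          rw [Finset.inter_insert_of_notMem haS]
          refine hinv.found_notMem haS ⟨j, hjR, hjS⟩ ?_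
          have h1 := hc.2
          rw [(depth_eq hRf hRpos s.D).1] at h1
          exact ENNReal.toReal_le_of_le_ofReal (by positivity) h1
      · exact fun h => (hmem' j).1 hjR (h hjS)
      · simp only
        push_cast
        linarith
    · left
      push Not at hlast
      have haS : a ∈ S := by
        rcases List.mem_cons.1 hi₀Q with h1 | h1
        · exact h1 ▸ hi₀S
        · exact absurd hi₀S (hlast _ h1)
      refine ⟨?_, a, haS, ?_⟩
      · intro i hi
        by_contra hni
        simp only [Finset.mem_insert, not_or] at hni
        rcases List.mem_cons.1 ((hQmem i).2 hni.2) with h1 | h1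
        · exact hni.1 h1
        · exact hlast _ h1 hi
      · have h1 := hinv.found_last haS hlast
        have h2 : ∑ i ∈ S ∩ s.found, I.realDist i ≤ ∑ j ∈ S.erase a, I.realDist j := by
          apply Finset.sum_le_sum_of_subset_of_nonneg
          · intro i hi
            rw [Finset.mem_inter] at hi
            exact Finset.mem_erase.2 ⟨fun h => hafound (h ▸ hi.2), hi.1⟩
          · intro i _ _
            exact ENNReal.toReal_nonneg
        simp only
        rw [htr, ← I.ofReal_realDist hc.1, ← ENNReal.ofReal_add (by positivity) (by positivity)]
        apply ENNReal.ofReal_le_ofReal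
        rw [lastBound]
        have h3 := mul_le_mul_of_nonneg_left h2 (by positivity : 0 ≤ 1 + Real.exp 1)
        linarith
  · right
    have hR0 : R ≠ [] := by
      intro h0
      apply hc
      refine ⟨I.mem_targets.1 (hS (hone h0)), ?_⟩
      have : ¬ s.f < m := by
        rw [h0, List.length_nil] at hRf; omega
      rw [depth, if_neg this]
      exact le_top
    have hRpos : 0 < R.length := List.length_pos_iff.2 hR0
    obtain ⟨hdep, hbase⟩ := depth_eq hRf hRpos s.D
    have hstep : WeightedSearch.step I s =
      { rays := s.rays
        f := s.f
        r := (s.r + 1) % (m - s.f + 1)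
        D := s.D * base m s.f
        found := s.found
        travelled := s.travelled + s.away + depth m s.f s.D
        away := depth m s.f s.D } := by
      simp only [WeightedSearch.step, hlookup]
      rw [if_neg hc]
    have hmf : m - s.f + 1 = s.rays.length := by omega
    have hrot : s.rays.rotate ((s.r + 1) % (m - s.f + 1)) = R ++ [a] := by
      rw [hmf, List.rotate_mod, ← List.rotate_rotate, hQ]
      simp
    rw [hstep]
    refine ⟨⟨?_, ?_, ?_, ?_, ?_⟩, ?_, ?_⟩
    · simp only [hmf]
      exact Nat.mod_lt _ (by omega)
    · exact hlen
    · exact hnd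
    · exact hmem
    · simp only [hrot, hdep, hbase]
      refine ⟨_, _, ?_, ?_, hinv.vain hR0 ?_⟩
      · positivity
      · rw [htr, ← ENNReal.ofReal_add (by positivity) (by positivity),
          ← ENNReal.ofReal_add (by positivity) (by positivity)]
        congr 1; ring
      · intro haS
        have hfin := I.mem_targets.1 (hS haS)
        rw [hdep] at hc
        have h1 : ENNReal.ofReal (s.D * (1 + 1 / (R.length : ℝ))) ≤ I.dist a := by
          by_contra h2
          exact hc ⟨hfin, (not_le.1 h2).le⟩
        exact (ENNReal.ofReal_le_iff_le_toReal hfin).1 h1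
    · exact hne
    · simp only [hbase]
      have h1 : (1:ℝ) ≤ m / R.length := by
        rw [one_le_div (by exact_mod_cast hRpos)]
        exact_mod_cast (by omega : R.length ≤ m)
      have h2 : s.D * (1 + 1 / (R.length : ℝ)) * m = s.D * m + s.D * (m / R.length) := by ring
      nlinarith

theorem travelled_le_step (I : Instance m) (s : State m) :
    s.travelled ≤ (step I s).travelled := by
  unfold step
  split
  · exact le_rfl
  · split_ifs <;> simp only [add_assoc] <;> exact le_self_add

theorem run_succ (I : Instance m) (k : ℕ) : run I (k + 1) = step I (run I k) :=
  Function.iterate_succ_apply' _ _ _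

theorem travelled_run_mono (I : Instance m) : Monotone fun k => (run I k).travelled :=
  monotone_nat_of_le_succ fun k => by
    simp only [run_succ]
    exact travelled_le_step _ _

theorem run_dichotomy (I : Instance m) {S : Finset (Fin m)} (hS : S ⊆ I.targets)
    (hne : S.Nonempty) (k : ℕ) :
    (∃ n, S ⊆ (run I n).found ∧ ∃ i ∈ S,
      (run I n).travelled ≤ ENNReal.ofReal (lastBound I S i)) ∨
    (Progress I S (run I k) ∧ ¬ S ⊆ (run I k).found ∧
      (k : ℝ) ≤ (run I k).D * m + (run I k).f) := by
  induction k with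
  | zero =>
    right
    refine ⟨Progress.init I hS hne, ?_, ?_⟩
    · simpa [run, State.init] using hne.ne_empty
    · simp only [run, State.init, Function.iterate_zero, id]
      push_cast
      positivity
  | succ k ih =>
    rcases ih with h | ⟨h1, h2, h3⟩
    · exact Or.inl h
    · rcases h1.step hS h2 with h | ⟨h4, h5, h6⟩
      · exact Or.inl ⟨k + 1, by rwa [run_succ]⟩
      · right
        rw [run_succ]
        refine ⟨h4, h5, ?_⟩
        push_cast
        linarith

theorem Progress.bounded {I : Instance m} {S : Finset (Fin m)} {s : State m} (h : Progress I S s)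
    (hne : ¬ S ⊆ s.found) :
    s.D * m + s.f ≤ Real.exp 1 * (∑ i ∈ S, I.realDist i) * m + m := by
  obtain ⟨hr, hlen, hnd, hmem, C, T, hT, htr, hinv⟩ := h
  obtain ⟨i, hiS, hi⟩ : ∃ i ∈ S, i ∉ s.found := by
    simpa [Finset.subset_iff] using hne
  obtain ⟨A, B, hAB⟩ := List.append_of_mem
    (List.mem_rotate.2 ((hmem i).2 hi) : i ∈ s.rays.rotate s.r)
  have h1 := hinv.depth_le A i B hAB hiS
  have hD := hinv.one_le
  have hl : (((s.rays.rotate s.r).length : ℝ) - 1) = ((A.length + B.length : ℕ) : ℝ) := by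
    rw [hAB]; push_cast [List.length_append, List.length_cons]; ring
  have h2 : s.D ≤ s.D * (1 + 1 / (((s.rays.rotate s.r).length : ℝ) - 1)) ^ A.length := by
    apply le_mul_of_one_le_right (by linarith)
    apply one_le_pow₀
    rw [hl]
    have : (0:ℝ) ≤ 1 / ((A.length + B.length : ℕ) : ℝ) := by positivity
    linarith
  have h3 : I.realDist i ≤ ∑ j ∈ S, I.realDist j :=
    Finset.single_le_sum (fun j _ => ENNReal.toReal_nonneg) hiS
  have h4 : s.D ≤ Real.exp 1 * ∑ j ∈ S, I.realDist j :=
    (h2.trans h1).trans (mul_le_mul_of_nonneg_left h3 (Real.exp_pos 1).le)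
  have h5 : (s.f : ℝ) ≤ m := by exact_mod_cast (by omega : s.f ≤ m)
  have h6 := mul_le_mul_of_nonneg_right h4 (Nat.cast_nonneg m : (0:ℝ) ≤ m)
  linarith

theorem exists_found (I : Instance m) {S : Finset (Fin m)} (hS : S ⊆ I.targets)
    (hne : S.Nonempty) :
    ∃ n, S ⊆ (run I n).found ∧ ∃ i ∈ S,
      (run I n).travelled ≤ ENNReal.ofReal (lastBound I S i) := by
  obtain ⟨k, hk⟩ := exists_nat_gt (Real.exp 1 * (∑ i ∈ S, I.realDist i) * m + m)
  rcases run_dichotomy I hS hne k with h | ⟨h1, h2, h3⟩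
  · exact h
  · linarith [h1.bounded h2]

/-! ### Comparison with the optimum -/

theorem Instance.mem_feasible (I : Instance m) {S : Finset (Fin m)} :
    S ∈ I.feasible ↔ S ⊆ I.targets ∧ I.W ≤ I.totalWeight S := by
  simp [Instance.feasible]

theorem factor_nonneg (q : ℕ) : 0 ≤ factor q := by
  unfold factor phi
  split_ifs <;> positivity

theorem factor_eq {q : ℕ} (h : q ≠ 0) : factor q = 1 + 2 * ((q + 1) * growth q) := by
  rw [factor, if_neg h, phi, growth, Real.rpow_natCast]
  ring

/-- The most distant target of `S` and the saving of not returning from it. -/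
theorem Instance.exists_setCost_eq (I : Instance m) {S : Finset (Fin m)} (hne : S.Nonempty) :
    ∃ i ∈ S, (∀ j ∈ S, I.dist j ≤ I.dist i) ∧
      I.setCost S = 2 * ∑ j ∈ S, I.realDist j - I.realDist i := by
  obtain ⟨i, hi, h⟩ := Finset.exists_mem_eq_sup S hne I.dist
  refine ⟨i, hi, fun j hj => h ▸ Finset.le_sup hj, ?_⟩
  rw [setCost, h]
  rfl

theorem Instance.sum_le_setCost (I : Instance m) {S : Finset (Fin m)} (hne : S.Nonempty) :
    ∑ j ∈ S, I.realDist j ≤ I.setCost S := by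
  obtain ⟨i, hi, -, h⟩ := I.exists_setCost_eq hne
  have : I.realDist i ≤ ∑ j ∈ S, I.realDist j :=
    Finset.single_le_sum (fun j _ => ENNReal.toReal_nonneg) hi
  linarith

theorem Instance.setCost_pos (I : Instance m) {S : Finset (Fin m)} (hS : S ⊆ I.targets)
    (hne : S.Nonempty) : 0 < I.setCost S :=
  lt_of_lt_of_le (Finset.sum_pos (fun _ hi => zero_lt_one.trans_le
    (I.one_le_realDist (I.mem_targets.1 (hS hi)))) hne) (I.sum_le_setCost hne)

theorem lastBound_le (I : Instance m) {S : Finset (Fin m)} (hS : S ⊆ I.targets) {i : Fin m}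
    (hi : i ∈ S) : lastBound I S i ≤ factor (m - S.card) * I.setCost S := by
  obtain ⟨j, hj, hmax, hcost⟩ := I.exists_setCost_eq ⟨i, hi⟩
  have hle : I.realDist i ≤ I.realDist j :=
    ENNReal.toReal_mono (I.mem_targets.1 (hS hj)) (hmax i hi)
  have hsum := Finset.add_sum_erase S I.realDist hi
  have hi1 := I.one_le_realDist (I.mem_targets.1 (hS hi))
  have hu : 0 ≤ ∑ k ∈ S.erase i, I.realDist k :=
    Finset.sum_nonneg fun _ _ => ENNReal.toReal_nonneg
  have hj2 : I.realDist j = I.realDist i ∨ I.realDist j ≤ ∑ k ∈ S.erase i, I.realDist k := by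
    rcases eq_or_ne j i with rfl | hji
    · exact Or.inl rfl
    · exact Or.inr (Finset.single_le_sum (f := I.realDist) (fun k _ => ENNReal.toReal_nonneg)
        (Finset.mem_erase.2 ⟨hji, hj⟩))
  rw [lastBound, hcost, ← hsum]
  set u := ∑ k ∈ S.erase i, I.realDist k
  set x := I.realDist i
  set y := I.realDist j
  have he := Real.exp_one_lt_d9
  have he1 := Real.exp_one_gt_d9
  rcases Nat.eq_zero_or_pos (m - S.card) with hq | hq
  · rw [hq, growth_zero, factor, if_pos rfl]
    push_cast
    have hyu : y ≤ x + u := by rcases hj2 with h | h <;> linarith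
    have h1 : (3 + 2 * Real.exp 1) * (x + u) ≤ (3 + 2 * Real.exp 1) * (2 * (x + u) - y) :=
      mul_le_mul_of_nonneg_left (by linarith) (by positivity)
    have h2 : 0 ≤ Real.exp 1 * x := by positivity
    linarith
  · rw [factor_eq hq.ne']
    have hG : (8:ℝ) ≤ 2 * (((m - S.card : ℕ) + 1) * growth (m - S.card)) := by
      have h1 := two_le_growth hq
      have h2 : (1:ℝ) ≤ (m - S.card : ℕ) := by exact_mod_cast hq
      nlinarith
    set G := 2 * ((((m - S.card : ℕ) : ℝ) + 1) * growth (m - S.card))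
    have e1 : 2 * ((((m - S.card : ℕ) : ℝ) + 1) * growth (m - S.card) * x +
        (1 + Real.exp 1) * u) + x = G * x + 2 * (1 + Real.exp 1) * u + x := by
      simp only [G]; ring
    rw [e1]
    have h3 : Real.exp 1 * u ≤ 2.7182818286 * u := by gcongr
    rcases hj2 with h | h
    · rw [h]
      nlinarith
    · have h4 : G * u ≤ G * (x + 2 * u - y) := by
        apply mul_le_mul_of_nonneg_left _ (by linarith)
        linarith
      have h5 : 8 * u ≤ G * u := mul_le_mul_of_nonneg_right hG hu
      linarith

theorem adSchCost_le (I : Instance m) {n : ℕ} (h : I.W ≤ I.totalWeight (run I n).found) :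
    adSchCost I ≤ (run I n).travelled := by
  classical
  have hex : ∃ k, I.W ≤ I.totalWeight (run I k).found := ⟨n, h⟩
  rw [adSchCost, dif_pos hex]
  exact travelled_run_mono I (Nat.find_min' hex h)

theorem adSchCost_eq_zero (I : Instance m) (h : I.W ≤ 0) : adSchCost I = 0 := by
  have h0 : I.W ≤ I.totalWeight (run I 0).found := by
    simpa [run, State.init, Instance.totalWeight] using h
  have := adSchCost_le I h0
  simpa [run, State.init] using this

theorem nonempty_of_feasible (I : Instance m) (hW : 0 < I.W) {S : Finset (Fin m)}
    (hS : S ∈ I.feasible) : S.Nonempty := by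
  rw [Finset.nonempty_iff_ne_empty]
  rintro rfl
  have := (I.mem_feasible.1 hS).2
  simp only [Instance.totalWeight, Finset.sum_empty] at this
  linarith

theorem adSchCost_le_of_feasible (I : Instance m) (hW : 0 < I.W) {S : Finset (Fin m)}
    (hS : S ∈ I.feasible) :
    adSchCost I ≤ ENNReal.ofReal (factor (m - S.card) * I.setCost S) := by
  obtain ⟨hST, hSW⟩ := I.mem_feasible.1 hS
  obtain ⟨n, hn, i, hi, hle⟩ := exists_found I hST (nonempty_of_feasible I hW hS)
  have h1 : I.W ≤ I.totalWeight (run I n).found :=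
    hSW.trans (Finset.sum_le_sum_of_subset_of_nonneg hn fun j _ _ => I.weight_nonneg j)
  exact ((adSchCost_le I h1).trans hle).trans (ENNReal.ofReal_le_ofReal (lastBound_le I hST hi))

theorem Instance.opt_pos (I : Instance m) (hW : 0 < I.W) : 0 < I.opt := by
  rw [opt, Finset.lt_inf'_iff]
  exact fun S hS => I.setCost_pos (I.mem_feasible.1 hS).1 (nonempty_of_feasible I hW hS)

theorem Instance.xi_le_factor (I : Instance m) : I.xi ≤ factor (m - I.maxOptCard) := by
  classical
  obtain ⟨S₀, hS₀, hS₀eq⟩ := Finset.exists_mem_eq_inf' I.feasible_nonempty I.setCost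
  obtain ⟨S, hS, hcard⟩ := Finset.exists_mem_eq_sup {S ∈ I.feasible | I.setCost S = I.opt}
    ⟨S₀, Finset.mem_filter.2 ⟨hS₀, hS₀eq.symm⟩⟩ Finset.card
  obtain ⟨hSf, hSo⟩ := Finset.mem_filter.1 hS
  have hmax : I.maxOptCard = S.card := by
    rw [maxOptCard, ← hcard]
  rw [hmax]
  refine (Finset.inf'_le _ hSf).trans ?_
  rw [hSo]
  exact mul_le_of_le_one_right (factor_nonneg _) (div_self_le_one _)

end WeightedSearch

end

theorem theorem6 {m : ℕ} (I : WeightedSearch.Instance m) :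
    WeightedSearch.adSchCost I ≤ ENNReal.ofReal (I.xi * I.opt) ∧
      I.xi ≤ WeightedSearch.factor (m - I.maxOptCard) := by
  refine ⟨?_, I.xi_le_factor⟩
  rcases le_or_gt I.W 0 with hW | hW
  · rw [WeightedSearch.adSchCost_eq_zero I hW]
    exact zero_le
  · obtain ⟨S, hS, hxi⟩ := Finset.exists_mem_eq_inf' I.feasible_nonempty
      fun S => WeightedSearch.factor (m - S.card) * (I.setCost S / I.opt)
    have h1 : I.xi * I.opt = WeightedSearch.factor (m - S.card) * I.setCost S := by
      rw [WeightedSearch.Instance.xi, hxi, mul_assoc, div_mul_cancel₀ _ (I.opt_pos hW).ne']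
    rw [h1]
    exact WeightedSearch.adSchCost_le_of_feasible I hW hS
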